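/- A diffeological vector space is a real vector space $V$ with a diffeology for which addition $V\times V\to V$ and scalar multiplication $\mathbb R\times V\to V$ are smooth; $\mathrm{DVect}$ is the category of diffeological vector spaces and smooth linear maps, and $L^\infty(V,W)$ is the vector space of smooth linear maps $V\to W$. A short exact sequence $0\to V\xrightarrow{i}A\xrightarrow{\pi}W\to 0$ in $\mathrm{DVect}$ is a sequence of smooth linear maps that is short exact as a sequence of vector spaces, with $i$ an induction and $\pi$ a subduction. It splits smoothly if $\pi$ has a smooth linear section. Two such sequences, with middle terms $A$ and $A'$, are equivalent if there is an isomorphism $A\cong A'$ in $\mathrm{DVect}$ compatible with the identity maps of $V$ and $W$; $e(W,V)$ denotes the set of equivalence classes. A diffeological vector space $P$ is projective if for every linear subduction $W_1\to W_2$, every smooth linear map $P\to W_2$ lifts to a smooth linear map $P\to W_1$. A projective resolution of $W$ is a sequence $\cdots\to P_2\xrightarrow{d_2}P_1\xrightarrow{d_1}P_0\xrightarrow{\varepsilon}W\to 0$ in $\mathrm{DVect}$, exact as a sequence of vector spaces, in which every $P_n$ is projective, $\varepsilon$ is a subduction and each $d_n$ is a subduction onto its image (with the sub-diffeology). Given such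 a resolution, $\mathrm{Ext}^n(W,V)$ is the $n$-th cohomology of the complex $L^\infty(P_0,V)\to L^\infty(P_1,V)\to\cdots$ induced by the $d_n$; in particular $$\mathrm{Ext}^1(W,V)=\frac{\{f\in L^\infty(P_1,V): f\circ d_2=0\}}{\{h\circ d_1: h\in L^\infty(P_0,V)\}} .$$ **Theorem.** Let $V$ and $W$ be diffeological vector spaces. Then $W$ has a projective resolution, and for every projective resolution of $W$ the following hold. 1. There is a bijection $\psi:e(W,V)\to\mathrm{Ext}^1(W,V)$ such that, for every short exact sequence $0\to V\xrightarrow{i}A\xrightarrow{\pi}W\to0$ in $\mathrm{DVect}$ and every $f\in L^\infty(P_1,V)$ with $f\circ d_2=0$, $\psi$ sends the class of the sequence to $[f]$ if and only if there is a smooth linear map $g:P_0\to A$ with $\pi\circ g=\varepsilon$ and $i\circ f=g\circ d_1$. Moreover $\psi$ sends the class of a sequence to $0$ if and only if the sequence splits smoothly. 2. $\mathrm{Ext}^1(W,V)=0$ if and only if every short exact sequence $0\to V\to A\to W\to0$ in $\mathrm{DVect}$ splits smoothly. -/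

import Mathlib

open Diffeology

universe u

namespace DVS

section Diffeologies

variable {X Y : Type*} [DiffeologicalSpace X] [DiffeologicalSpace Y]

/-- The product diffeology: a map into `X × Y` is a plot iff both components are plots. -/
instance prodDiffeology : DiffeologicalSpace (X × Y) where
  plots n := {p : EuclideanSpace ℝ (Fin n) → X × Y |
    IsPlot (fun x => (p x).1) ∧ IsPlot (fun x => (p x).2)}
  constant_plots x := ⟨isPlot_const, isPlot_const⟩
  plot_reparam hp hf := ⟨isPlot_reparam hp.1 hf, isPlot_reparam hp.2 hf⟩
  locality {n p} h := by
    refine ⟨DiffeologicalSpace.locality fun x => ?_, DiffeologicalSpace.locality fun x => ?_⟩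
    · obtain ⟨u, hu, hx, h'⟩ := h x
      exact ⟨u, hu, hx, fun hfu hf => (h' hfu hf).1⟩
    · obtain ⟨u, hu, hx, h'⟩ := h x
      exact ⟨u, hu, hx, fun hfu hf => (h' hfu hf).2⟩

/-- The sub-diffeology: a map into a subset is a plot iff it is a plot of the ambient space. -/
instance subtypeDiffeology {s : X → Prop} : DiffeologicalSpace (Subtype s) where
  plots n := {p : EuclideanSpace ℝ (Fin n) → Subtype s | IsPlot (fun x => (p x : X))}
  constant_plots x := isPlot_const
  plot_reparam hp hf := isPlot_reparam (X := X) hp hf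
  locality {n p} h := by
    refine DiffeologicalSpace.locality fun x => ?_
    obtain ⟨u, hu, hx, h'⟩ := h x
    exact ⟨u, hu, hx, fun hfu hf => h' hfu hf⟩

/-- An induction: an injective map whose domain carries the pulled back diffeology. -/
def IsInduction (f : X → Y) : Prop :=
  Function.Injective f ∧
    ∀ (n : ℕ) (p : EuclideanSpace ℝ (Fin n) → X), IsPlot p ↔ IsPlot (f ∘ p)

/-- A subduction: a smooth surjection along which every plot lifts locally to a plot (that is,
the codomain carries the quotient diffeology). Since every point of an open subset `u` of `ℝⁿ` has
a neighbourhood on which a smooth map `ℝⁿ → u` is the identity, it makes no difference whether the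
local lift is asked to be a plot on a small open set or the restriction of a plot on `ℝⁿ`. -/
def IsSubduction (f : X → Y) : Prop :=
  DSmooth f ∧ Function.Surjective f ∧
    ∀ (n : ℕ) (p : EuclideanSpace ℝ (Fin n) → Y), IsPlot p →
      ∀ x, ∃ u : Set (EuclideanSpace ℝ (Fin n)), IsOpen u ∧ x ∈ u ∧
        ∃ q : EuclideanSpace ℝ (Fin n) → X, IsPlot q ∧ ∀ y ∈ u, f (q y) = p y

end Diffeologies

end DVS

/-- Diffeological vector spaces: real vector spaces with a diffeology for which addition and
scalar multiplication are smooth. -/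
structure DVect : Type (u + 1) where
  carrier : Type u
  [addCommGroup : AddCommGroup carrier]
  [module : Module ℝ carrier]
  [diffeology : DiffeologicalSpace carrier]
  smooth_add : DSmooth (fun x : carrier × carrier => x.1 + x.2)
  smooth_smul : DSmooth (fun x : ℝ × carrier => x.1 • x.2)

namespace DVect

open DVS

instance : CoeSort DVect.{u} (Type u) := ⟨DVect.carrier⟩

attribute [instance] DVect.addCommGroup DVect.module DVect.diffeology

theorem dSmooth_add_fun {X : Type*} [DiffeologicalSpace X] {V : DVect.{u}} {f g : X → V}
    (hf : DSmooth f) (hg : DSmooth g) : DSmooth (fun x => f x + g x) :=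
  fun n p hp => V.smooth_add n (fun y => (f (p y), g (p y))) ⟨hf n p hp, hg n p hp⟩

theorem dSmooth_smul_fun {X : Type*} [DiffeologicalSpace X] {V : DVect.{u}} (c : ℝ) {f : X → V}
    (hf : DSmooth f) : DSmooth (fun x => c • f x) :=
  fun n p hp => V.smooth_smul n (fun y => (c, f (p y))) ⟨isPlot_const, hf n p hp⟩

/-- The vector space of smooth linear maps `V → W`. -/
def SmoothLin (V W : DVect.{u}) : Submodule ℝ (V →ₗ[ℝ] W) where
  carrier := {f | DSmooth f}
  add_mem' hf hg := dSmooth_add_fun hf hg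
  zero_mem' := dSmooth_const (y := (0 : W))
  smul_mem' c _ hf := dSmooth_smul_fun c hf

instance (V W : DVect.{u}) : AddCommGroup (SmoothLin V W) := Submodule.addCommGroup _

/-- Precomposition with a smooth linear map `f : V → V'`. -/
def precomp {V V' : DVect.{u}} (f : SmoothLin V V') (W : DVect.{u}) :
    SmoothLin V' W →ₗ[ℝ] SmoothLin V W where
  toFun g := ⟨g.1 ∘ₗ f.1, DSmooth.comp (Y := V') (show DSmooth g.1 from g.2) (show DSmooth f.1 from f.2)⟩
  map_add' _ _ := rfl
  map_smul' _ _ := rfl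

/-- Projectivity with respect to linear subductions. -/
def IsProjective (P : DVect.{u}) : Prop :=
  ∀ (W₁ W₂ : DVect.{u}) (f : SmoothLin W₁ W₂) (g : SmoothLin P W₂), IsSubduction f.1 →
    ∃ h : SmoothLin P W₁, f.1 ∘ₗ h.1 = g.1

/-- A short exact sequence `0 → V → A → W → 0` of diffeological vector spaces: exact as a sequence
of vector spaces, with `V → A` an induction and `A → W` a subduction. -/
structure ShortExactSeq (V W : DVect.{u}) : Type (u + 1) where
  A : DVect.{u}
  i : SmoothLin V A
  π : SmoothLin A W
  exact : Function.Exact i.1 π.1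
  isInduction : IsInduction i.1
  isSubduction : IsSubduction π.1

namespace ShortExactSeq

variable {V W : DVect.{u}}

/-- Equivalence of short exact sequences: an isomorphism of diffeological vector spaces between
the middle terms that is compatible with the identity maps of `V` and `W`. -/
def Equivalent (S T : ShortExactSeq V W) : Prop :=
  ∃ f : S.A ≃ₗ[ℝ] T.A, DSmooth f ∧ DSmooth f.symm ∧
    (∀ v, f (S.i.1 v) = T.i.1 v) ∧ (∀ a, T.π.1 (f a) = S.π.1 a)

instance setoid (V W : DVect.{u}) : Setoid (ShortExactSeq V W) where
  r := Equivalent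
  iseqv :=
    { refl := fun S => ⟨LinearEquiv.refl ℝ S.A, dSmooth_id, dSmooth_id, fun _ => rfl, fun _ => rfl⟩
      symm := by
        rintro S T ⟨f, h1, h2, h3, h4⟩
        exact ⟨f.symm, h2, h1, fun v => by rw [← h3, f.symm_apply_apply],
          fun a => by rw [← h4, f.apply_symm_apply]⟩
      trans := by
        rintro S T R ⟨f, h1, h2, h3, h4⟩ ⟨g, k1, k2, k3, k4⟩
        exact ⟨f.trans g, k1.comp h1, h2.comp k2, fun v => by simp [h3, k3],
          fun a => by simp [h4, k4]⟩ }

/-- The sequence splits smoothly: the map `A → W` has a smooth linear section. -/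
def SplitsSmoothly (S : ShortExactSeq V W) : Prop :=
  ∃ q : SmoothLin W S.A, S.π.1 ∘ₗ q.1 = LinearMap.id

end ShortExactSeq

/-- The set `e(W, V)` of equivalence classes of short exact sequences `0 → V → A → W → 0`. -/
def ExtClasses (W V : DVect.{u}) : Type (u + 1) :=
  Quotient (ShortExactSeq.setoid V W)

/-- A smooth linear map is strict if it is a subduction onto its image, the image carrying the
sub-diffeology; equivalently, the induced injection `V / ker f → W` is an induction. -/
def IsStrict {V W : DVect.{u}} (f : SmoothLin V W) : Prop :=
  IsSubduction f.1.rangeRestrict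

/-- A projective resolution `⋯ → P₂ → P₁ → P₀ → W → 0` of `W`: a complex of diffeological vector
spaces that is exact as a complex of vector spaces, with all differentials strict (at the spot `W`
this says that `ε : P₀ → W` is a subduction), and with all `Pₙ` projective. -/
structure ProjRes (W : DVect.{u}) : Type (u + 1) where
  P : ℕ → DVect.{u}
  d : ∀ n, SmoothLin (P (n + 1)) (P n)
  ε : SmoothLin (P 0) W
  projective : ∀ n, IsProjective (P n)
  isSubduction : IsSubduction ε.1
  exact_zero : Function.Exact (d 0).1 ε.1
  exact_succ : ∀ n, Function.Exact (d (n + 1)).1 (d n).1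
  strict : ∀ n, IsStrict (d n)

namespace ProjRes

variable {W : DVect.{u}}

/-- The `n`-cocycles of the cochain complex `L^∞(P₀, V) → L^∞(P₁, V) → ⋯`. -/
def cocycles (R : ProjRes W) (V : DVect.{u}) (n : ℕ) : Submodule ℝ (SmoothLin (R.P n) V) :=
  LinearMap.ker (precomp (R.d n) V)

/-- The `n`-coboundaries of the cochain complex `L^∞(P₀, V) → L^∞(P₁, V) → ⋯`. -/
def coboundaries (R : ProjRes W) (V : DVect.{u}) :
    ∀ n : ℕ, Submodule ℝ (SmoothLin (R.P n) V)
  | 0 => ⊥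
  | n + 1 => LinearMap.range (precomp (R.d n) V)

/-- The vector space `Extⁿ(W, V)`, as the `n`-th cohomology of the cochain complex
`L^∞(P₀, V) → L^∞(P₁, V) → ⋯` for the resolution `P → W`. -/
abbrev Ext (R : ProjRes W) (V : DVect.{u}) (n : ℕ) : Type u :=
  R.cocycles V n ⧸ (R.coboundaries V n).submoduleOf (R.cocycles V n)

/-- The class in `Extⁿ(W, V)` of a cocycle. -/
def extClass (R : ProjRes W) {V : DVect.{u}} {n : ℕ} (f : R.cocycles V n) : R.Ext V n :=
  Submodule.Quotient.mk f

end ProjRes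

end DVect

/-! Projectivity of `P 0` lifts `ε` through `π` to some `g : P 0 → A`. Since `ε ∘ d₁ = 0`, the map
`g ∘ d₁` lands in the image of the induction `i`, hence is `i ∘ f` for a smooth cocycle `f`. Two
choices of `g` differ by a smooth map `P 0 → V`, so only the class of `f` is determined
(`exists_classifies`, `Classifies.extClass_eq`, `Classifies.of_extClass_eq`).

Conversely `f` determines the sequence: `(v, x) ↦ i v + g x` is a subduction `V × P 0 → A` whose
kernel `{(-f y, d₁ y)}` involves `f` alone (`Classifies.equivalent`). Dividing by this subspace
realizes every cocycle; strictness of `d₁` is what makes the resulting `V → A` an induction. For `f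
= 0` the lift `g` kills `ker ε` and descends to a section.

The analytic input is `exists_isPlot_lift`: linearity allows local lifts of plots to be glued. It
makes free spaces projective, and covers by these give resolutions. In the code `R.d 0` is `d₁` and
`R.d 1` is `d₂`. -/

namespace DVect

open DVS
open scoped ContDiff Manifold

/-! ### Plots in diffeological vector spaces and their lifts -/

section Plots

variable {V : DVect.{u}} {n : ℕ}

theorem isPlot_add {p q : EuclideanSpace ℝ (Fin n) → V} (hp : IsPlot p) (hq : IsPlot q) :
    IsPlot (fun x => p x + q x) :=
  V.smooth_add n (fun x => (p x, q x)) ⟨hp, hq⟩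

theorem isPlot_smul {c : EuclideanSpace ℝ (Fin n) → ℝ} {p : EuclideanSpace ℝ (Fin n) → V}
    (hc : IsPlot c) (hp : IsPlot p) : IsPlot (fun x => c x • p x) :=
  V.smooth_smul n (fun x => (c x, p x)) ⟨hc, hp⟩

theorem isPlot_sub {p q : EuclideanSpace ℝ (Fin n) → V} (hp : IsPlot p) (hq : IsPlot q) :
    IsPlot (fun x => p x - q x) := by
  have h := isPlot_add hp (isPlot_smul (c := fun _ => -1) isPlot_const hq)
  simpa only [neg_one_smul, ← sub_eq_add_neg] using h

theorem isPlot_sum {ι : Type*} (s : Finset ι) {c : ι → EuclideanSpace ℝ (Fin n) → ℝ}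
    {p : ι → EuclideanSpace ℝ (Fin n) → V} (hc : ∀ i, IsPlot (c i)) (hp : ∀ i, IsPlot (p i)) :
    IsPlot (fun x => ∑ i ∈ s, c i x • p i x) := by
  classical
  induction s using Finset.induction_on with
  | empty => simpa using isPlot_const
  | insert a s ha ih =>
    simp only [Finset.sum_insert ha]
    exact isPlot_add (isPlot_smul (hc a) (hp a)) ih

/-- A map that agrees locally with plots is a plot. -/
theorem isPlot_of_local {X : Type*} [DiffeologicalSpace X] {p : EuclideanSpace ℝ (Fin n) → X}
    (h : ∀ x, ∃ u : Set (EuclideanSpace ℝ (Fin n)), IsOpen u ∧ x ∈ u ∧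
      ∃ q : EuclideanSpace ℝ (Fin n) → X, IsPlot q ∧ ∀ y ∈ u, q y = p y) : IsPlot p := by
  refine DiffeologicalSpace.locality fun x => ?_
  obtain ⟨u, hu, hx, q, hq, hqp⟩ := h x
  refine ⟨u, hu, hx, fun {m f} hfu hf => ?_⟩
  have : p ∘ f = q ∘ f := funext fun y => (hqp _ (hfu y)).symm
  rw [this]
  exact isPlot_reparam hq hf

/-- Every point of an open set `u` has a neighbourhood on which some smooth map into `u` is the
identity. -/
theorem exists_contDiff_into_eq_id {u : Set (EuclideanSpace ℝ (Fin n))} (hu : IsOpen u)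
    {x : EuclideanSpace ℝ (Fin n)} (hx : x ∈ u) :
    ∃ f : EuclideanSpace ℝ (Fin n) → EuclideanSpace ℝ (Fin n), ContDiff ℝ ∞ f ∧ (∀ y, f y ∈ u) ∧
      ∃ v, IsOpen v ∧ x ∈ v ∧ ∀ y ∈ v, f y = y := by
  obtain ⟨ε, hε, hεu⟩ := Metric.isOpen_iff.1 hu x hx
  let b : ContDiffBump x := ⟨ε / 2, ε, half_pos hε, half_lt_self hε⟩
  -- Inside the ball of radius `ε` the bump only moves `y` towards `x`; outside, everything goes to
  -- `x`.
  refine ⟨fun y => x + b y • (y - x), ?_, fun y => hεu ?_, Metric.ball x (ε / 2),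
    Metric.isOpen_ball, Metric.mem_ball_self (half_pos hε), fun y hy => ?_⟩
  · exact contDiff_const.add (b.contDiff.smul (contDiff_id.sub contDiff_const))
  · rw [Metric.mem_ball, dist_eq_norm, add_sub_cancel_left, norm_smul]
    by_cases hy : y ∈ Metric.ball x ε
    · rw [Metric.mem_ball, dist_eq_norm] at hy
      refine lt_of_le_of_lt ?_ hy
      rw [Real.norm_of_nonneg b.nonneg]
      exact mul_le_of_le_one_left (norm_nonneg _) b.le_one
    · rw [b.zero_of_le_dist (by simpa using hy)]
      simpa using hε
  · have : b y = 1 := b.one_of_mem_closedBall (Metric.ball_subset_closedBall hy)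
    simp [this]

end Plots

/-- Plots lift globally along linear subductions, by a partition of unity. -/
theorem exists_isPlot_lift {V W : DVect.{u}} {f : V →ₗ[ℝ] W} (hf : IsSubduction f) {n : ℕ}
    {p : EuclideanSpace ℝ (Fin n) → W} (hp : IsPlot p) :
    ∃ q : EuclideanSpace ℝ (Fin n) → V, IsPlot q ∧ ∀ y, f (q y) = p y := by
  choose u hu hxu q hq hqp using hf.2.2 n p hp
  obtain ⟨ρ, hρ⟩ := SmoothPartitionOfUnity.exists_isSubordinate
    𝓘(ℝ, EuclideanSpace ℝ (Fin n)) isClosed_univ u hu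
    (fun x _ => Set.mem_iUnion.2 ⟨x, hxu x⟩)
  have hρc : ∀ i, IsPlot (ρ i) := fun i => (ρ i).contMDiff.contDiff.isPlot
  refine ⟨fun y => ∑ᶠ i, ρ i y • q i y, isPlot_of_local fun x => ?_, fun y => ?_⟩
  · obtain ⟨t, ht, hfin⟩ := ρ.locallyFinite x
    refine ⟨interior t, isOpen_interior, mem_interior_iff_mem_nhds.2 ht,
      fun y => ∑ i ∈ hfin.toFinset, ρ i y • q i y, isPlot_sum _ hρc hq, fun y hy => ?_⟩
    refine (finsum_eq_sum_of_support_subset _ fun i hi => ?_).symm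
    rw [Set.Finite.coe_toFinset]
    exact ⟨y, fun h0 => hi (by simp only [h0, zero_smul]), interior_subset hy⟩
  · have hfin : {i | ρ i y ≠ 0}.Finite := ρ.locallyFinite.point_finite y
    have h1 : ∑ᶠ i, ρ i y = 1 := ρ.sum_eq_one (Set.mem_univ y)
    rw [finsum_eq_sum_of_support_subset (s := hfin.toFinset) _ (by simp [Function.support])] at h1
    dsimp only
    rw [finsum_eq_sum_of_support_subset (s := hfin.toFinset), map_sum]
    -- Each `q i` lifts `p` on the support of `ρ i`, so a weighted average of lifts is again a lift.
    · calc ∑ i ∈ hfin.toFinset, f (ρ i y • q i y) = ∑ i ∈ hfin.toFinset, ρ i y • p y := by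
            refine Finset.sum_congr rfl fun i hi => ?_
            have hi' : ρ i y ≠ 0 := by simpa using hi
            rw [map_smul, hqp i y (hρ i (subset_tsupport _ hi'))]
        _ = p y := by rw [← Finset.sum_smul, h1, one_smul]
    · intro i hi
      simp only [Set.Finite.coe_toFinset, Set.mem_ofPred_eq]
      exact fun h0 => hi (by simp only [h0, zero_smul])

/-- A linear map out of the codomain of a linear subduction is smooth when its composite with the
subduction is. -/
theorem dSmooth_of_comp_isSubduction {V W : DVect.{u}} {Y : Type*} [DiffeologicalSpace Y]
    {f : V →ₗ[ℝ] W} (hf : IsSubduction f) {g : W → Y} (h : DSmooth (g ∘ f)) : DSmooth g := by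
  intro n p hp
  obtain ⟨q, hq, hqp⟩ := exists_isPlot_lift hf hp
  obtain rfl : f ∘ q = p := funext hqp
  exact h n q hq

/-! ### Products, subspaces and quotients -/

section Constructions

/-- The product of two diffeological vector spaces. -/
def prod (V W : DVect.{u}) : DVect.{u} where
  carrier := V × W
  diffeology := prodDiffeology
  smooth_add _ _ hp := ⟨isPlot_add hp.1.1 hp.2.1, isPlot_add hp.1.2 hp.2.2⟩
  smooth_smul _ _ hp := ⟨isPlot_smul hp.1 hp.2.1, isPlot_smul hp.1 hp.2.2⟩

/-- A linear subspace with the sub-diffeology. -/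
def subspace (V : DVect.{u}) (K : Submodule ℝ V) : DVect.{u} where
  carrier := K
  smooth_add _ _ hp := isPlot_add (V := V) hp.1 hp.2
  smooth_smul _ _ hp := isPlot_smul (V := V) hp.1 hp.2

/-- The quotient diffeology on `V / N`: plots are the maps that lift locally to plots of `V`. -/
@[reducible]
def quotientDiffeology (V : DVect.{u}) (N : Submodule ℝ V) : DiffeologicalSpace (V ⧸ N) where
  plots n := {p | ∀ x, ∃ u : Set (EuclideanSpace ℝ (Fin n)), IsOpen u ∧ x ∈ u ∧
    ∃ q : EuclideanSpace ℝ (Fin n) → V, IsPlot q ∧ ∀ y ∈ u, N.mkQ (q y) = p y}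
  constant_plots a x := by
    obtain ⟨v, hv⟩ := N.mkQ_surjective a
    exact ⟨Set.univ, isOpen_univ, trivial, fun _ => v, isPlot_const, fun _ _ => hv⟩
  plot_reparam {n m p f} hp hf x := by
    obtain ⟨u, hu, hx, q, hq, h⟩ := hp (f x)
    exact ⟨f ⁻¹' u, hu.preimage hf.continuous, hx, q ∘ f, isPlot_reparam hq hf, fun y hy => h _ hy⟩
  locality {n p} h x := by
    obtain ⟨u, hu, hx, h'⟩ := h x
    -- Locality only tests `p` on globally defined smooth maps into `u`, so the restriction of `p`
    -- near `x` is replaced by `p ∘ f`.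
    obtain ⟨f, hf, hfu, v, hv, hxv, hfv⟩ := exists_contDiff_into_eq_id hu hx
    obtain ⟨w, hw, hxw, q, hq, hqp⟩ := h' hfu hf x
    refine ⟨v ∩ w, hv.inter hw, ⟨hxv, hxw⟩, q, hq, fun y hy => ?_⟩
    rw [hqp y hy.2, Function.comp_apply, hfv y hy.1]

/-- The quotient of a diffeological vector space by a linear subspace. -/
def quotient (V : DVect.{u}) (N : Submodule ℝ V) : DVect.{u} where
  carrier := V ⧸ N
  diffeology := quotientDiffeology V N
  smooth_add n p hp x := by
    obtain ⟨u, hu, hx, q, hq, h⟩ := hp.1 x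
    obtain ⟨u', hu', hx', q', hq', h'⟩ := hp.2 x
    refine ⟨u ∩ u', hu.inter hu', ⟨hx, hx'⟩, _, isPlot_add hq hq', fun y hy => ?_⟩
    rw [map_add, h y hy.1, h' y hy.2]
    rfl
  smooth_smul n p hp x := by
    obtain ⟨u, hu, hx, q, hq, h⟩ := hp.2 x
    refine ⟨u, hu, hx, _, isPlot_smul hp.1 hq, fun y hy => ?_⟩
    rw [map_smul, h y hy]
    rfl

/-- The projection onto a quotient. -/
def quotientMk (V : DVect.{u}) (N : Submodule ℝ V) : SmoothLin V (V.quotient N) :=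
  ⟨N.mkQ, fun _ p hp _ => ⟨Set.univ, isOpen_univ, trivial, p, hp, fun _ _ => rfl⟩⟩

theorem isSubduction_quotientMk (V : DVect.{u}) (N : Submodule ℝ V) :
    IsSubduction (V.quotientMk N).1 :=
  ⟨(V.quotientMk N).2, N.mkQ_surjective, fun _ _ hp => hp⟩

end Constructions

/-! ### Free diffeological vector spaces and enough projectives -/

section Free

variable {ι : Type u} (dim : ι → ℕ)

/-- The diffeologies on the vector space with basis `⨿ i, ℝ^(dim i)` that make it a diffeological
vector space in which all basis inclusions of the `ℝ^(dim i)` are plots. -/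
def freeDiffeologies : Set (DiffeologicalSpace ((Σ i, EuclideanSpace ℝ (Fin (dim i))) →₀ ℝ)) :=
  {_D | DSmooth (fun x : ((Σ i, EuclideanSpace ℝ (Fin (dim i))) →₀ ℝ) ×
      ((Σ i, EuclideanSpace ℝ (Fin (dim i))) →₀ ℝ) => x.1 + x.2) ∧
    DSmooth (fun x : ℝ × ((Σ i, EuclideanSpace ℝ (Fin (dim i))) →₀ ℝ) => x.1 • x.2) ∧
    ∀ i, IsPlot (fun x : EuclideanSpace ℝ (Fin (dim i)) =>
      (Finsupp.single ⟨i, x⟩ 1 : (Σ i, EuclideanSpace ℝ (Fin (dim i))) →₀ ℝ))}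

/-- The free diffeological vector space on the disjoint union of the `ℝ^(dim i)`. -/
noncomputable def free : DVect.{u} where
  carrier := (Σ i, EuclideanSpace ℝ (Fin (dim i))) →₀ ℝ
  diffeology := sInf (freeDiffeologies dim)
  smooth_add n p hp := by
    refine DiffeologicalSpace.isPlot_sInf_iff.2 fun D hD => ?_
    exact hD.1 n p ⟨DiffeologicalSpace.isPlot_sInf_iff.1 hp.1 D hD,
      DiffeologicalSpace.isPlot_sInf_iff.1 hp.2 D hD⟩
  smooth_smul n p hp := by
    refine DiffeologicalSpace.isPlot_sInf_iff.2 fun D hD => ?_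
    exact hD.2.1 n p ⟨hp.1, DiffeologicalSpace.isPlot_sInf_iff.1 hp.2 D hD⟩

/-- The inclusion of a summand `ℝ^(dim i)` into the free diffeological vector space. -/
noncomputable def freeOf (i : ι) (x : EuclideanSpace ℝ (Fin (dim i))) : free dim :=
  (Finsupp.single ⟨i, x⟩ 1 : (Σ i, EuclideanSpace ℝ (Fin (dim i))) →₀ ℝ)

theorem isPlot_freeOf (i : ι) : IsPlot (freeOf dim i) :=
  DiffeologicalSpace.isPlot_sInf_iff.2 fun _ hD => hD.2.2 i

variable {dim}

/-- The diffeology pulled back along a map. -/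
@[reducible]
def inducedDiffeology {X Y : Type*} [DiffeologicalSpace Y] (f : X → Y) :
    DiffeologicalSpace X where
  plots n := {p : EuclideanSpace ℝ (Fin n) → X | IsPlot (fun x => f (p x))}
  constant_plots x := isPlot_const
  plot_reparam hp hf := isPlot_reparam (X := Y) hp hf
  locality {n p} h := by
    refine DiffeologicalSpace.locality fun x => ?_
    obtain ⟨u, hu, hx, h'⟩ := h x
    exact ⟨u, hu, hx, fun hfu hf => h' hfu hf⟩

/-- The diffeology pulled back along the linear extension belongs to `freeDiffeologies`, so every
plot of the infimum is a plot for it; this is smoothness of the extension. -/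
theorem exists_freeLift {V : DVect.{u}} {q : ∀ i, EuclideanSpace ℝ (Fin (dim i)) → V}
    (hq : ∀ i, IsPlot (q i)) :
    ∃ f : SmoothLin (free dim) V, ∀ i x, f.1 (freeOf dim i x) = q i x := by
  let f : ((Σ i, EuclideanSpace ℝ (Fin (dim i))) →₀ ℝ) →ₗ[ℝ] V :=
    Finsupp.linearCombination ℝ fun s : Σ i, EuclideanSpace ℝ (Fin (dim i)) => q s.1 s.2
  have hf : ∀ i x, f (Finsupp.single ⟨i, x⟩ 1) = q i x := fun i x => by simp [f]
  have hD : inducedDiffeology f ∈ freeDiffeologies dim := by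
    refine ⟨fun n p hp => ?_, fun n p hp => ?_, fun i => ?_⟩
    · have := isPlot_add (V := V) hp.1 hp.2
      simp only [← map_add] at this
      exact this
    · have := isPlot_smul (V := V) hp.1 hp.2
      simp only [← map_smul] at this
      exact this
    · change IsPlot (fun x => f (Finsupp.single ⟨i, x⟩ 1))
      simpa only [hf] using hq i
  exact ⟨⟨f, fun n p hp => DiffeologicalSpace.isPlot_sInf_iff.1 hp _ hD⟩, hf⟩

theorem free_hom_ext {V : Type*} [AddCommGroup V] [Module ℝ V] {f g : free dim →ₗ[ℝ] V}
    (h : ∀ i x, f (freeOf dim i x) = g (freeOf dim i x)) : f = g := by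
  refine Finsupp.lhom_ext' (M := ℝ) (R := ℝ) (φ := f) (ψ := g) fun s => ?_
  exact LinearMap.ext_ring (h s.1 s.2)

/-- A lift is prescribed on each generating plot. These plots live on a whole `ℝⁿ`, which is why
global lifts are needed. -/
theorem isProjective_free : IsProjective (free dim) := by
  intro W₁ W₂ f g hf
  choose q hq hqg using fun i =>
    exists_isPlot_lift hf ((isPlot_freeOf dim i).dSmooth_comp (show DSmooth g.1 from g.2))
  obtain ⟨h, hh⟩ := exists_freeLift hq
  exact ⟨h, free_hom_ext fun i x => by rw [LinearMap.comp_apply, hh, hqg]; rfl⟩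

/-- There are enough projectives. -/
theorem exists_projective_cover (W : DVect.{u}) :
    ∃ (P : DVect.{u}) (ε : SmoothLin P W), IsProjective P ∧ IsSubduction ε.1 := by
  -- One generating copy of `ℝⁿ` for each plot of `W`: every plot lifts tautologically to its own
  -- generator, and the plots on `ℝ⁰` give surjectivity.
  let ι : Type u := Σ n : ℕ, {p : EuclideanSpace ℝ (Fin n) → W // IsPlot p}
  obtain ⟨ε, hε⟩ := exists_freeLift (dim := fun i : ι => i.1) (V := W) (q := fun i => i.2.1)
    fun i => i.2.2
  refine ⟨_, ε, isProjective_free, ε.2, fun w => ⟨_, hε (⟨0, fun _ => w, isPlot_const⟩ : ι) 0⟩,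
    fun n p hp x => ⟨Set.univ, isOpen_univ, trivial, freeOf (fun i : ι => i.1) ⟨n, p, hp⟩,
      isPlot_freeOf (fun i : ι => i.1) ⟨n, p, hp⟩, fun y _ => hε ⟨n, p, hp⟩ y⟩⟩

end Free

/-! ### Existence of projective resolutions -/

section Resolution

/-- A linear subduction from a projective diffeological vector space onto `W`. -/
structure ProjCover (W : DVect.{u}) : Type (u + 1) where
  P : DVect.{u}
  map : SmoothLin P W
  projective : IsProjective P
  isSubduction : IsSubduction map.1

instance (W : DVect.{u}) : Nonempty (ProjCover W) :=
  let ⟨P, ε, h, h'⟩ := exists_projective_cover W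
  ⟨⟨P, ε, h, h'⟩⟩

/-- The kernel of a projective cover. -/
def ProjCover.kernel {W : DVect.{u}} (C : ProjCover W) : DVect.{u} :=
  C.P.subspace (LinearMap.ker C.map.1)

/-- The inclusion of the kernel of a projective cover. -/
def ProjCover.kernelι {W : DVect.{u}} (C : ProjCover W) : SmoothLin C.kernel C.P :=
  ⟨(LinearMap.ker C.map.1).subtype, fun _ _ hp => hp⟩

/-- Iterated syzygies of `W` with their projective covers. -/
noncomputable def syzygy (W : DVect.{u}) : ℕ → Σ K : DVect.{u}, ProjCover K
  | 0 => ⟨W, Classical.arbitrary _⟩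
  | n + 1 => ⟨(syzygy W n).2.kernel, Classical.arbitrary _⟩

/-- The composite of smooth linear maps. -/
def SmoothLin.comp {U V W : DVect.{u}} (g : SmoothLin V W) (f : SmoothLin U V) : SmoothLin U W :=
  precomp f W g

theorem ProjCover.exact_kernelι_comp {W : DVect.{u}} (C : ProjCover W) (C' : ProjCover C.kernel) :
    Function.Exact (SmoothLin.comp C.kernelι C'.map).1 C.map.1 := by
  intro x
  constructor
  · intro hx
    obtain ⟨y, hy⟩ := C'.isSubduction.2.1 ⟨x, hx⟩
    exact ⟨y, congrArg Subtype.val hy⟩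
  · rintro ⟨y, rfl⟩
    exact (C'.map.1 y).2

/-- The image is the kernel of `C.map`, with the same sub-diffeology, and `C'.map` is a subduction
onto that kernel. -/
theorem ProjCover.isStrict_kernelι_comp {W : DVect.{u}} (C : ProjCover W)
    (C' : ProjCover C.kernel) : IsStrict (SmoothLin.comp C.kernelι C'.map) := by
  refine ⟨(SmoothLin.comp C.kernelι C'.map).2, LinearMap.surjective_rangeRestrict _, fun n p hp x => ?_⟩
  have hker : ∀ y, (p y).1 ∈ LinearMap.ker C.map.1 := fun y =>
    (C.exact_kernelι_comp C' _).2 (p y).2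
  obtain ⟨u, hu, hx, q, hq, h⟩ := C'.isSubduction.2.2 n (fun y => ⟨(p y).1, hker y⟩) hp x
  refine ⟨u, hu, hx, q, hq, fun y hy => ?_⟩
  have e : C.kernelι.1 (C'.map.1 (q y)) = (p y).1 := congrArg C.kernelι.1 (h y hy)
  exact Subtype.ext e

theorem nonempty_projRes (W : DVect.{u}) : Nonempty (ProjRes W) :=
  ⟨{ P := fun n => (syzygy W n).2.P
     d := fun n => SmoothLin.comp (syzygy W n).2.kernelι (syzygy W (n + 1)).2.map
     ε := (syzygy W 0).2.map
     projective := fun n => (syzygy W n).2.projective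
     isSubduction := (syzygy W 0).2.isSubduction
     exact_zero := (syzygy W 0).2.exact_kernelι_comp (syzygy W 1).2
     exact_succ := fun n => by
       intro x
       rw [← (syzygy W (n + 1)).2.exact_kernelι_comp (syzygy W (n + 2)).2 x]
       exact ⟨fun h => Subtype.ext h, fun h => congrArg Subtype.val h⟩
     strict := fun n => (syzygy W n).2.isStrict_kernelι_comp (syzygy W (n + 1)).2 }⟩

end Resolution

/-! ### The correspondence between short exact sequences and 1-cocycles -/

section Comparison

variable {V W : DVect.{u}}

namespace ProjRes

/-- A short exact sequence `S` is classified by `f : P₁ → V` if `f` is the restriction along `d₁`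
of a smooth linear lift `P₀ → A` of the augmentation. -/
def Classifies (R : ProjRes W) (S : ShortExactSeq V W) (f : SmoothLin (R.P 1) V) : Prop :=
  ∃ g : SmoothLin (R.P 0) S.A, S.π.1 ∘ₗ g.1 = R.ε.1 ∧ S.i.1 ∘ₗ f.1 = g.1 ∘ₗ (R.d 0).1

end ProjRes

namespace ShortExactSeq

/-- A smooth linear map into the middle term that is killed by the projection factors through the
inclusion. -/
theorem exists_lift (S : ShortExactSeq V W) {U : DVect.{u}} (g : SmoothLin U S.A)
    (hg : ∀ x, S.π.1 (g.1 x) = 0) : ∃ f : SmoothLin U V, ∀ x, S.i.1 (f.1 x) = g.1 x := by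
  choose f hf using fun x => (S.exact _).1 (hg x)
  refine ⟨⟨⟨⟨f, fun x y => S.isInduction.1 ?_⟩, fun c x => S.isInduction.1 ?_⟩,
    fun n p hp => (S.isInduction.2 n _).2 ?_⟩, hf⟩
  · rw [map_add, hf, hf, hf, map_add]
  · simp only [RingHom.id_apply, map_smul, hf]
  · have : S.i.1 ∘ f ∘ p = g.1 ∘ p := funext fun x => hf (p x)
    change IsPlot (S.i.1 ∘ f ∘ p)
    rw [this]
    exact g.2 n p hp

theorem π_i (S : ShortExactSeq V W) (v : V) : S.π.1 (S.i.1 v) = 0 :=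
  (S.exact _).2 ⟨v, rfl⟩

/-- The map `V × P → A` given by the inclusion and a lift of a subduction `P → W` is a
subduction. -/
theorem isSubduction_coprod (S : ShortExactSeq V W) {P : DVect.{u}} {ε : SmoothLin P W}
    (hε : IsSubduction ε.1) (g : SmoothLin P S.A) (hg : ∀ x, S.π.1 (g.1 x) = ε.1 x) :
    IsSubduction (X := V.prod P) (S.i.1.coprod g.1) := by
  refine ⟨fun n p hp => isPlot_add (S.i.2 n _ hp.1) (g.2 n _ hp.2), fun a => ?_, fun n p hp x => ?_⟩
  · obtain ⟨x, hx⟩ := hε.2.1 (S.π.1 a)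
    obtain ⟨v, hv⟩ := (S.exact (a - g.1 x)).1 (by rw [map_sub, hg, hx, sub_self])
    exact ⟨(v, x), by rw [LinearMap.coprod_apply, hv, sub_add_cancel]⟩
  -- With `q` a lift of `π ∘ p`, the plot `p - g ∘ q` takes values in the image of `i`, so it comes
  -- from a plot of `V`.
  · obtain ⟨q, hq, hqp⟩ := exists_isPlot_lift hε
      (hp.dSmooth_comp (show DSmooth S.π.1 from S.π.2))
    choose v hv using fun y => (S.exact (p y - g.1 (q y))).1
      (by rw [map_sub, hg, hqp, Function.comp_apply, sub_self])
    have hvp : IsPlot v := by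
      refine (S.isInduction.2 n v).2 ?_
      have : S.i.1 ∘ v = fun y => p y - g.1 (q y) := funext hv
      rw [this]
      exact isPlot_sub hp (g.2 n q hq)
    refine ⟨Set.univ, isOpen_univ, trivial, fun y => (v y, q y), ⟨hvp, hq⟩, fun y _ => ?_⟩
    rw [LinearMap.coprod_apply, hv, sub_add_cancel]

end ShortExactSeq

/-- Linear subductions with the same kernel have isomorphic codomains. -/
theorem exists_equiv_of_ker_eq {U A B : DVect.{u}} {f : U →ₗ[ℝ] A} {g : U →ₗ[ℝ] B}
    (hf : IsSubduction f) (hg : IsSubduction g) (h : LinearMap.ker f = LinearMap.ker g) :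
    ∃ e : A ≃ₗ[ℝ] B, DSmooth e ∧ DSmooth e.symm ∧ ∀ x, e (f x) = g x := by
  let e : A ≃ₗ[ℝ] B := (f.quotKerEquivOfSurjective hf.2.1).symm ≪≫ₗ
    Submodule.quotEquivOfEq _ _ h ≪≫ₗ g.quotKerEquivOfSurjective hg.2.1
  have he : ∀ x, e (f x) = g x := fun x => by
    have : (f.quotKerEquivOfSurjective hf.2.1).symm (f x) = Submodule.Quotient.mk x := by
      rw [LinearEquiv.symm_apply_eq]
      rfl
    simp only [e, LinearEquiv.trans_apply, this]
    rfl
  refine ⟨e, dSmooth_of_comp_isSubduction hf ?_, dSmooth_of_comp_isSubduction hg ?_, he⟩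
  · have : e ∘ f = g := funext he
    rw [this]
    exact hg.1
  · have : e.symm ∘ g = f := funext fun x => by simp [← he]
    rw [this]
    exact hf.1

namespace ProjRes

variable (R : ProjRes W)

theorem ε_d (y : R.P 1) : R.ε.1 ((R.d 0).1 y) = 0 :=
  (R.exact_zero _).2 ⟨y, rfl⟩

theorem d_d (z : R.P 2) : (R.d 0).1 ((R.d 1).1 z) = 0 :=
  (R.exact_succ 0 _).2 ⟨z, rfl⟩

theorem mem_cocycles_one {f : SmoothLin (R.P 1) V} :
    f ∈ R.cocycles V 1 ↔ ∀ z, f.1 ((R.d 1).1 z) = 0 := by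
  rw [cocycles, LinearMap.mem_ker, Subtype.ext_iff, LinearMap.ext_iff]
  rfl

theorem extClass_eq_iff {f f' : R.cocycles V 1} :
    R.extClass f = R.extClass f' ↔
      ∃ h : SmoothLin (R.P 0) V, ∀ y, h.1 ((R.d 0).1 y) = f.1.1 y - f'.1.1 y := by
  rw [extClass, extClass, Submodule.Quotient.eq, Submodule.submoduleOf, Submodule.mem_comap]
  refine exists_congr fun h => ?_
  rw [Subtype.ext_iff, LinearMap.ext_iff]
  rfl

theorem exists_classifies (S : ShortExactSeq V W) :
    ∃ f : R.cocycles V 1, R.Classifies S f.1 := by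
  obtain ⟨g, hg⟩ := R.projective 0 _ _ S.π R.ε S.isSubduction
  have hg' : ∀ x, S.π.1 (g.1 x) = R.ε.1 x := LinearMap.congr_fun hg
  obtain ⟨f, hf⟩ := S.exists_lift (SmoothLin.comp g (R.d 0)) fun x => (hg' _).trans (R.ε_d x)
  have hf' : ∀ y, S.i.1 (f.1 y) = g.1 ((R.d 0).1 y) := hf
  refine ⟨⟨f, R.mem_cocycles_one.2 fun z => S.isInduction.1 ?_⟩, g, hg, LinearMap.ext hf⟩
  rw [hf', d_d, map_zero, map_zero]

variable {R}

/-- The difference of two lifts of `ε` is killed by `π`, hence factors through `V`; this factor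
bounds `f - f'`. -/
theorem Classifies.extClass_eq {S : ShortExactSeq V W} {f f' : R.cocycles V 1}
    (h : R.Classifies S f.1) (h' : R.Classifies S f'.1) : R.extClass f = R.extClass f' := by
  obtain ⟨g, hg, hf⟩ := h
  obtain ⟨g', hg', hf'⟩ := h'
  obtain ⟨k, hk⟩ := S.exists_lift (g - g') fun x => by
    have h1 := LinearMap.congr_fun hg x
    have h2 := LinearMap.congr_fun hg' x
    simp only [LinearMap.comp_apply] at h1 h2
    change S.π.1 (g.1 x - g'.1 x) = 0
    rw [map_sub, h1, h2, sub_self]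
  refine R.extClass_eq_iff.2 ⟨k, fun y => S.isInduction.1 ?_⟩
  have h1 := LinearMap.congr_fun hf y
  have h2 := LinearMap.congr_fun hf' y
  simp only [LinearMap.comp_apply] at h1 h2
  rw [hk, map_sub, h1, h2]
  rfl

theorem Classifies.of_extClass_eq {S : ShortExactSeq V W} {f f' : R.cocycles V 1}
    (h : R.Classifies S f.1) (hff : R.extClass f = R.extClass f') : R.Classifies S f'.1 := by
  obtain ⟨g, hg, hf⟩ := h
  obtain ⟨k, hk⟩ := R.extClass_eq_iff.1 hff
  refine ⟨g - SmoothLin.comp S.i k, LinearMap.ext fun x => ?_, LinearMap.ext fun y => ?_⟩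
  · have h1 := LinearMap.congr_fun hg x
    simp only [LinearMap.comp_apply] at h1
    change S.π.1 (g.1 x - S.i.1 (k.1 x)) = R.ε.1 x
    rw [map_sub, h1, S.π_i, sub_zero]
  · have h1 := LinearMap.congr_fun hf y
    simp only [LinearMap.comp_apply] at h1
    change S.i.1 (f'.1.1 y) = g.1 ((R.d 0).1 y) - S.i.1 (k.1 ((R.d 0).1 y))
    rw [hk, map_sub, ← h1, sub_sub_cancel]

theorem Classifies.of_equivalent {S T : ShortExactSeq V W} {f : SmoothLin (R.P 1) V}
    (h : R.Classifies S f) (e : S.Equivalent T) : R.Classifies T f := by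
  obtain ⟨g, hg, hf⟩ := h
  obtain ⟨e, he, -, hi, hπ⟩ := e
  refine ⟨SmoothLin.comp ⟨e.toLinearMap, he⟩ g, LinearMap.ext fun x => ?_,
    LinearMap.ext fun y => ?_⟩
  · exact (hπ _).trans (LinearMap.congr_fun hg x)
  · exact (hi _).symm.trans (congrArg e (LinearMap.congr_fun hf y))

/-- The graph `{(-f y, d y)}` by which `V × P₀` has to be divided to obtain the sequence classified
by `f`. -/
def relations (R : ProjRes W) (f : SmoothLin (R.P 1) V) : Submodule ℝ (V.prod (R.P 0)) :=
  LinearMap.range ((-f.1).prod (R.d 0).1)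

theorem mem_relations {f : SmoothLin (R.P 1) V} {v : V} {x : R.P 0} :
    ((v, x) : V × R.P 0) ∈ R.relations f ↔ ∃ y, -f.1 y = v ∧ (R.d 0).1 y = x := by
  refine exists_congr fun y => ?_
  exact Prod.ext_iff

theorem ker_coprod_eq_relations {S : ShortExactSeq V W} {f : SmoothLin (R.P 1) V}
    {g : SmoothLin (R.P 0) S.A} (hg : ∀ x, S.π.1 (g.1 x) = R.ε.1 x)
    (hf : ∀ y, S.i.1 (f.1 y) = g.1 ((R.d 0).1 y)) :
    LinearMap.ker (S.i.1.coprod g.1) = R.relations f := by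
  ext ⟨v, x⟩
  rw [LinearMap.mem_ker, LinearMap.coprod_apply]
  refine Iff.trans ?_ mem_relations.symm
  constructor
  · intro h
    have hx : R.ε.1 x = 0 := by
      have h' := congrArg S.π.1 h
      rwa [map_add, S.π_i, zero_add, hg, map_zero] at h'
    obtain ⟨y, rfl⟩ := (R.exact_zero x).1 hx
    refine ⟨y, S.isInduction.1 ?_, rfl⟩
    rw [map_neg, hf]
    exact (eq_neg_of_add_eq_zero_left h).symm
  · rintro ⟨y, rfl, rfl⟩
    rw [map_neg, hf, neg_add_cancel]

/-- Both middle terms are quotients of `V × P 0` by the same subspace `R.relations f`. -/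
theorem Classifies.equivalent {S T : ShortExactSeq V W} {f : SmoothLin (R.P 1) V}
    (h : R.Classifies S f) (h' : R.Classifies T f) : S.Equivalent T := by
  obtain ⟨g, hg, hf⟩ := h
  obtain ⟨k, hk, hf'⟩ := h'
  have hg : ∀ x, S.π.1 (g.1 x) = R.ε.1 x := LinearMap.congr_fun hg
  have hk : ∀ x, T.π.1 (k.1 x) = R.ε.1 x := LinearMap.congr_fun hk
  have hs := S.isSubduction_coprod R.isSubduction g hg
  obtain ⟨e, he, he', hec⟩ := exists_equiv_of_ker_eq (U := V.prod (R.P 0)) hs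
    (T.isSubduction_coprod R.isSubduction k hk)
    ((ker_coprod_eq_relations hg (LinearMap.congr_fun hf)).trans
      (ker_coprod_eq_relations hk (LinearMap.congr_fun hf')).symm)
  have hec' : ∀ v x, e (S.i.1 v + g.1 x) = T.i.1 v + k.1 x := fun v x => hec (v, x)
  refine ⟨e, he, he', fun v => ?_, fun a => ?_⟩
  · simpa using hec' v 0
  · obtain ⟨⟨v, x⟩, rfl⟩ := hs.2.1 a
    rw [LinearMap.coprod_apply]
    change T.π.1 (e (S.i.1 v + g.1 x)) = S.π.1 (S.i.1 v + g.1 x)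
    rw [hec', map_add, map_add, T.π_i, S.π_i, hk, hg]

/-- Every cocycle classifies a sequence, namely `0 → V → (V × P₀) / relations → W → 0`. -/
theorem exists_shortExactSeq_classifies (f : R.cocycles V 1) :
    ∃ S : ShortExactSeq V W, R.Classifies S f.1 := by
  let U := V.prod (R.P 0)
  let N : Submodule ℝ U := R.relations f.1
  have hcoc := R.mem_cocycles_one.1 f.2
  let i : SmoothLin V (U.quotient N) := SmoothLin.comp (U.quotientMk N)
    ⟨LinearMap.inl ℝ V (R.P 0), fun n p hp => ⟨hp, isPlot_const⟩⟩
  let g : SmoothLin (R.P 0) (U.quotient N) := SmoothLin.comp (U.quotientMk N)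
    ⟨LinearMap.inr ℝ V (R.P 0), fun n p hp => ⟨isPlot_const, hp⟩⟩
  let π' : U →ₗ[ℝ] W := R.ε.1 ∘ₗ LinearMap.snd ℝ V (R.P 0)
  have hπN : N ≤ LinearMap.ker π' := by
    rintro _ ⟨y, rfl⟩
    exact R.ε_d y
  have hsub := U.isSubduction_quotientMk N
  let π : SmoothLin (U.quotient N) W := ⟨N.liftQ π' hπN,
    dSmooth_of_comp_isSubduction hsub fun n p hp => R.ε.2 n _ hp.2⟩
  have hπ : ∀ v x, π.1 (N.mkQ ((v, x) : V × R.P 0)) = R.ε.1 x := fun _ _ => rfl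
  have hmk : ∀ (v v' : V) (x x' : R.P 0), N.mkQ ((v, x) : V × R.P 0) = N.mkQ ((v', x') : V × R.P 0)
      ↔ ∃ y, -f.1.1 y = v - v' ∧ (R.d 0).1 y = x - x' := fun _ _ _ _ =>
    (Submodule.Quotient.eq N).trans mem_relations
  -- Since `ker d₁ = im d₂`, the cocycle condition says that `f y` depends only on `d₁ y`.
  have hker : ∀ y, (R.d 0).1 y = 0 → f.1.1 y = 0 := fun y hy => by
    obtain ⟨z, rfl⟩ := (R.exact_succ 0 y).1 hy
    exact hcoc z
  refine ⟨⟨U.quotient N, i, π, ?_, ⟨?_, fun n p => ⟨fun hp => i.2 n p hp, fun hp => ?_⟩⟩,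
    ⟨π.2, ?_, fun n p hp x => ?_⟩⟩, g, LinearMap.ext fun x => rfl, LinearMap.ext fun y => ?_⟩
  · intro a
    obtain ⟨⟨v, x⟩, rfl⟩ := hsub.2.1 a
    constructor
    · intro hx
      obtain ⟨y, rfl⟩ := (R.exact_zero x).1 hx
      -- `(f y, -d₁ y)` is the relation coming from `-y`, so `(v, d₁ y)` and `(v + f y, 0)` have the
      -- same class.
      refine ⟨v + f.1.1 y, (hmk _ _ _ _).2 ⟨-y, ?_, ?_⟩⟩
      · simp
      · simp
    · rintro ⟨v', hv'⟩
      rw [← hv']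
      exact (hπ v' 0).trans (map_zero _)
  · intro v v' h
    obtain ⟨y, hy, hy'⟩ := (hmk v v' 0 0).1 h
    rw [hker y (by rw [hy', sub_zero]), neg_zero] at hy
    exact sub_eq_zero.1 hy.symm
  -- The second component of `q` is a plot in the image of `d₁`. Strictness lifts it locally to a
  -- plot `r` of `P 1`, and then `p = q.1 + f ∘ r` by `hker`.
  · obtain ⟨q, hq, hqp⟩ := exists_isPlot_lift hsub hp
    have hy : ∀ x, ∃ y, -f.1.1 y = (q x).1 - p x ∧ (R.d 0).1 y = (q x).2 - 0 := fun x =>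
      (hmk _ _ _ _).1 (hqp x)
    have hmem : ∀ x, (q x).2 ∈ LinearMap.range (R.d 0).1 := fun x => by
      obtain ⟨y, -, hy⟩ := hy x
      exact ⟨y, by rw [hy, sub_zero]⟩
    refine isPlot_of_local fun x => ?_
    obtain ⟨u, hu, hx, r, hr, hrq⟩ := (R.strict 0).2.2 n (fun x => ⟨(q x).2, hmem x⟩) hq.2 x
    refine ⟨u, hu, hx, fun z => (q z).1 + f.1.1 (r z),
      isPlot_add hq.1 (f.1.2 n r hr), fun z hz => ?_⟩
    obtain ⟨y, hy1, hy2⟩ := hy z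
    have h1 : (R.d 0).1 (r z) = (q z).2 := congrArg Subtype.val (hrq z hz)
    have h2 := hker (r z - y) (by rw [map_sub, h1, hy2, sub_zero, sub_self])
    rw [map_sub, sub_eq_zero] at h2
    dsimp only
    rw [h2, ← neg_neg (f.1.1 y), hy1]
    abel
  · intro w
    obtain ⟨x, hx⟩ := R.isSubduction.2.1 w
    exact ⟨g.1 x, hx⟩
  · obtain ⟨u, hu, hx, q, hq, h⟩ := R.isSubduction.2.2 n p hp x
    exact ⟨u, hu, hx, g.1 ∘ q, g.2 n q hq, h⟩
  · refine (hmk _ _ _ _).2 ⟨-y, ?_, ?_⟩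
    · simp
    · simp

/-- If `f = 0`, then `g` kills `im d₁ = ker ε` and descends along the subduction `ε` to a section. A
section `q` gives the lift `q ∘ ε`, which kills `im d₁`. -/
theorem classifies_zero_iff {S : ShortExactSeq V W} : R.Classifies S 0 ↔ S.SplitsSmoothly := by
  constructor
  · rintro ⟨g, hg, hf⟩
    have hker : LinearMap.ker R.ε.1 ≤ LinearMap.ker g.1 := fun x hx => by
      obtain ⟨y, rfl⟩ := (R.exact_zero x).1 hx
      exact (LinearMap.congr_fun hf y).symm.trans (map_zero S.i.1)
    let e := R.ε.1.quotKerEquivOfSurjective R.isSubduction.2.1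
    have he : ∀ x, e.symm (R.ε.1 x) = Submodule.Quotient.mk x := fun x => by
      rw [LinearEquiv.symm_apply_eq]
      rfl
    let q : W →ₗ[ℝ] S.A := (LinearMap.ker R.ε.1).liftQ g.1 hker ∘ₗ e.symm.toLinearMap
    have hq : ∀ x, q (R.ε.1 x) = g.1 x := fun x => by
      change (LinearMap.ker R.ε.1).liftQ g.1 hker (e.symm (R.ε.1 x)) = _
      rw [he]
      rfl
    refine ⟨⟨q, dSmooth_of_comp_isSubduction R.isSubduction ?_⟩, LinearMap.ext fun w => ?_⟩
    · have : q ∘ R.ε.1 = g.1 := funext hq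
      rw [this]
      exact g.2
    · obtain ⟨x, rfl⟩ := R.isSubduction.2.1 w
      change S.π.1 (q (R.ε.1 x)) = R.ε.1 x
      rw [hq]
      exact LinearMap.congr_fun hg x
  · rintro ⟨q, hq⟩
    refine ⟨SmoothLin.comp q R.ε, LinearMap.ext fun x => LinearMap.congr_fun hq _,
      LinearMap.ext fun y => ?_⟩
    change S.i.1 0 = q.1 (R.ε.1 ((R.d 0).1 y))
    rw [R.ε_d, map_zero, map_zero]

end ProjRes

end Comparison

end DVect

/-! ### The classification theorem -/

theorem theorem7p11 (V W : DVect.{u}) :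
    Nonempty (DVect.ProjRes W) ∧
    ∀ R : DVect.ProjRes W,
      (∃ ψ : DVect.ExtClasses W V → R.Ext V 1,
        Function.Bijective ψ ∧
        (∀ (S : DVect.ShortExactSeq V W) (f : R.cocycles V 1),
          ψ (Quotient.mk _ S) = R.extClass f ↔
            ∃ g : DVect.SmoothLin (R.P 0) S.A,
              S.π.1 ∘ₗ g.1 = R.ε.1 ∧ S.i.1 ∘ₗ f.1.1 = g.1 ∘ₗ (R.d 0).1) ∧
        (∀ S : DVect.ShortExactSeq V W, ψ (Quotient.mk _ S) = 0 ↔ S.SplitsSmoothly)) ∧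
      (Subsingleton (R.Ext V 1) ↔ ∀ S : DVect.ShortExactSeq V W, S.SplitsSmoothly) := by
  refine ⟨DVect.nonempty_projRes W, fun R => ?_⟩
  choose c hc using fun S : DVect.ShortExactSeq V W => R.exists_classifies S
  let ψ : DVect.ExtClasses W V → R.Ext V 1 := Quotient.lift (fun S => R.extClass (c S))
    fun S T h => ((hc S).of_equivalent h).extClass_eq (hc T)
  have hψ : ∀ (S : DVect.ShortExactSeq V W) (f : R.cocycles V 1),
      ψ (Quotient.mk _ S) = R.extClass f ↔ R.Classifies S f.1 := fun S f =>
    ⟨fun h => (hc S).of_extClass_eq h, fun h => (hc S).extClass_eq h⟩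
  have hsurj : Function.Surjective ψ := fun a => by
    obtain ⟨f, rfl⟩ := Submodule.Quotient.mk_surjective _ a
    obtain ⟨S, hS⟩ := DVect.ProjRes.exists_shortExactSeq_classifies f
    exact ⟨Quotient.mk _ S, (hψ S f).2 hS⟩
  have hinj : Function.Injective ψ := by
    rintro ⟨S⟩ ⟨T⟩ h
    -- Equality of classes lets the cocycle chosen for `T` classify `S` as well.
    exact Quotient.sound (((hψ S (c T)).1 h).equivalent (hc T))
  have hzero : ∀ S : DVect.ShortExactSeq V W,
      ψ (Quotient.mk _ S) = 0 ↔ S.SplitsSmoothly := fun S =>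
    (hψ S 0).trans DVect.ProjRes.classifies_zero_iff
  refine ⟨⟨ψ, ⟨hinj, hsurj⟩, hψ, hzero⟩, fun h S => (hzero S).1 (Subsingleton.elim _ _), fun h => ?_⟩
  refine subsingleton_of_forall_eq 0 fun a => ?_
  obtain ⟨⟨S⟩, rfl⟩ := hsurj a
  exact (hzero S).2 (h S)
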